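/- Let $\mathbb K$ be a (non-empty) first-order topological structure: an $\mathcal L$-structure with a topology that has $\{\Phi(\mathbb K,\bar a):\bar a\in\mathbb K^m\}$ as a basis, for some parameter-free formula $\Phi(x,\bar y)$. Let $T$ be its complete theory, $|T|=\max(\aleph_0,|\mathcal L|)$, and let $\mathbb M\succeq\mathbb K$ be a monster model, i.e. $\kappa$-saturated and strongly $\kappa$-homogeneous for some $\kappa>|T|$, with the topology generated by the sets $\Phi(\mathbb M,\bar a)$, $\bar a\in\mathbb M^m$. Finite powers carry the product topology. Assume that $\mathbb K$ is d-minimal, i.e. 1. $\mathbb K$ is $T_1$; 2. $\mathbb K$ has no isolated points; 3. every definable (with parameters) subset of $\mathbb M$ with empty interior is a finite union of discrete sets; 4. for every $n\ge 1$ and every definable discrete $X\subseteq\mathbb K^n$, the projection of $X$ to the first coordinate has empty interior; 5. if $X\subseteq\mathbb K^2$ and $U\subseteq\mathbb K$ are definable, $U$ is open, non-empty and contained in the projection of $X$ to the first coordinate, and $X_a=\{b:(a,b)\in X\}$ has non-empty interior for every $a\in U$, then $X$ has non-empty interior. For $A\subseteq\mathbb M$ and $b\in\mathbb M$ put $b\in\mathrm{zcl}(A)$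 iff there is an $A$-definable set $X\subseteq\mathbb M$ with empty interior and $b\in X$. Then: (a) $b\in\mathrm{zcl}(A)$ iff $b$ lies in some $A$-definable discrete subset of $\mathbb M$. (b) $\mathrm{zcl}$ is an existential matroid on $\mathbb M$, that is: - it is a finitary matroid: $X\subseteq\mathrm{zcl}(X)$; $X\subseteq Y$ implies $\mathrm{zcl}(X)\subseteq\mathrm{zcl}(Y)$; $\mathrm{zcl}(\mathrm{zcl}(X))=\mathrm{zcl}(X)$; $\mathrm{zcl}(X)=\bigcup\{\mathrm{zcl}(A):A\subseteq X\text{ finite}\}$; and $a\in\mathrm{zcl}(X\cup\{c\})\setminus\mathrm{zcl}(X)$ implies $c\in\mathrm{zcl}(X\cup\{a\})$; - it is definable: $\mathrm{zcl}(A)$ is the union of the sets $\varphi(\mathbb M,\bar a)$, where $\bar a$ is a finite tuple from $A$ and $\varphi(x,\bar y)$ is a parameter-free formula that is $x$-narrow, i.e. $\mathbb M\models\varphi(a,\bar b)$ implies $a\in\mathrm{zcl}(\bar b)$ for all $a,\bar b$; - it satisfies Existence: if $|B|,|C|<\kappa$ and $a\notin\mathrm{zcl}(B)$, then some $a'$ with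 the same type as $a$ over $B$ satisfies $a'\notin\mathrm{zcl}(B\cup C)$; - it is non-trivial: it is not the operator $X\mapsto\mathbb M$. (c) For every $X\subseteq\mathbb K$, the set $X$ is topologically dense in $\mathbb K$ iff it is dense with respect to $\mathrm{zcl}$, i.e. iff $X$ meets every $\mathbb K$-definable $U=\varphi(\mathbb K,\bar a)\subseteq\mathbb K$ ($\bar a$ a finite tuple from $\mathbb K$) of dimension $1$. Here the dimension of $U$ is the maximum of the ranks over $\bar a$, with respect to the matroid $\mathrm{zcl}$, of the elements of $\varphi(\mathbb M,\bar a)$ (and $-\infty$ if this set is empty). -/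

import Mathlib

universe u v w w'

open FirstOrder Set TopologicalSpace
open scoped Cardinal

namespace DMin



section General

variable {L : FirstOrder.Language.{u, v}} {M : Type w} [L.Structure M]

/-- The set `φ(M, a)` defined by `φ(x, y)` with the parameter tuple `a` substituted for `y`. -/
def fiber {n : ℕ} (φ : L.Formula (Fin 1 ⊕ Fin n)) (a : Fin n → M) : Set M :=
  {x | φ.Realize (Sum.elim (fun _ : Fin 1 => x) a)}

/-- The family of sets `Φ(M, a)`, where `a` ranges over the tuples of `M`. -/
def basicSets {m : ℕ} (Φ : L.Formula (Fin 1 ⊕ Fin m)) (M : Type w) [L.Structure M] :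
    Set (Set M) :=
  Set.range fun a : Fin m → M => fiber Φ a

/-- `a` and `a'` have the same type over `B`. -/
def SameType (L : FirstOrder.Language.{u, v}) [L.Structure M] (B : Set M) (a a' : M) : Prop :=
  ∀ φ : (L[[B]]).Formula (Fin 1), φ.Realize (fun _ => a) ↔ φ.Realize (fun _ => a')

/-- `κ`-saturation: every finitely satisfiable set of formulas in one variable, over a parameter
set of cardinality less than `κ`, is realized. -/
def IsSaturated (L : FirstOrder.Language.{u, v}) (M : Type w) [L.Structure M]
    (κ : Cardinal.{w}) : Prop :=
  ∀ A : Set M, #A < κ → ∀ p : Set ((L[[A]]).Formula (Fin 1)),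
    (∀ s : Finset ((L[[A]]).Formula (Fin 1)), ↑s ⊆ p →
      ∃ a : M, ∀ φ ∈ s, φ.Realize fun _ => a) →
    ∃ a : M, ∀ φ ∈ p, φ.Realize fun _ => a

/-- Strong `κ`-homogeneity: every partial elementary map whose domain has cardinality less than
`κ` extends to an automorphism. -/
def IsStronglyHomogeneous (L : FirstOrder.Language.{u, v}) (M : Type w) [L.Structure M]
    (κ : Cardinal.{w}) : Prop :=
  ∀ A : Set M, #A < κ → ∀ f : A → M,
    (∀ φ : L.Formula A, φ.Realize (fun a : A => (a : M)) ↔ φ.Realize f) →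
    ∃ σ : M ≃[L] M, ∀ a : A, σ a = f a

/-- `M` is a monster model with respect to `κ`; here `max ℵ₀ L.card` is the cardinality of its
theory. -/
structure IsMonster (L : FirstOrder.Language.{u, v}) (M : Type w) [L.Structure M]
    (κ : Cardinal.{w}) : Prop where
  card_lt : Cardinal.lift.{w} (max ℵ₀ L.card) < Cardinal.lift.{max u v} κ
  saturated : IsSaturated L M κ
  homogeneous : IsStronglyHomogeneous L M κ

end General

section Matroids

variable {M : Type w}

/-- A finitary matroid (pregeometry), given by its closure operator. -/
structure IsFinitaryMatroid (cl : Set M → Set M) : Prop where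
  extension : ∀ X, X ⊆ cl X
  monotone : ∀ X Y, X ⊆ Y → cl X ⊆ cl Y
  idempotent : ∀ X, cl (cl X) = cl X
  finitary : ∀ X, cl X = ⋃ A ∈ {A : Set M | A ⊆ X ∧ A.Finite}, cl A
  exchange : ∀ X a c, a ∈ cl (insert c X) → a ∉ cl X → c ∈ cl (insert a X)

/-- `φ(x, y)` is `x`-narrow for `cl`. -/
def IsNarrow {L : FirstOrder.Language.{u, v}} [L.Structure M] (cl : Set M → Set M) {n : ℕ}
    (φ : L.Formula (Fin 1 ⊕ Fin n)) : Prop :=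
  ∀ (b : Fin n → M) (a : M), a ∈ fiber φ b → a ∈ cl (Set.range b)

/-- `cl` is definable: `cl A` is the union of the sets `φ(M, a)` with `φ` narrow and `a` a finite
tuple from `A`. -/
def IsDefinableOperator (L : FirstOrder.Language.{u, v}) [L.Structure M]
    (cl : Set M → Set M) : Prop :=
  ∀ A : Set M, cl A = {x | ∃ (n : ℕ) (φ : L.Formula (Fin 1 ⊕ Fin n)) (a : Fin n → M),
    IsNarrow cl φ ∧ (∀ i, a i ∈ A) ∧ x ∈ fiber φ a}

/-- The Existence axiom, for parameter sets of cardinality less than `κ`. -/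
def SatisfiesExistence (L : FirstOrder.Language.{u, v}) [L.Structure M] (κ : Cardinal.{w})
    (cl : Set M → Set M) : Prop :=
  ∀ (a : M) (B C : Set M), #B < κ → #C < κ → a ∉ cl B →
    ∃ a' : M, SameType L B a a' ∧ a' ∉ cl (B ∪ C)

/-- An existential matroid: a definable matroid satisfying Existence, other than the trivial
matroid for which the closure of every set is the whole of `M`. -/
structure IsExistentialMatroid (L : FirstOrder.Language.{u, v}) [L.Structure M]
    (κ : Cardinal.{w}) (cl : Set M → Set M) : Prop where
  matroid : IsFinitaryMatroid cl
  definable : IsDefinableOperator L cl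
  existence : SatisfiesExistence L κ cl
  nontrivial : cl ≠ fun _ => Set.univ

/-- `S` is independent over `B`. -/
def IndepOver (cl : Set M → Set M) (B S : Set M) : Prop :=
  ∀ a ∈ S, a ∉ cl (B ∪ (S \ {a}))

/-- The rank of a tuple over `A`: the largest size of a set of its entries that is independent
over `A`. -/
noncomputable def rank (cl : Set M → Set M) {n : ℕ} (b : Fin n → M) (A : Set M) : ℕ∞ :=
  ⨆ S ∈ {S : Set M | S ⊆ Set.range b ∧ IndepOver cl A S}, S.encard

/-- The dimension of a set `V` of `n`-tuples that is definable over `A`: the maximum of the ranks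
over `A` of its elements, and `⊥` (that is, `-∞`) if `V` is empty. -/
noncomputable def dim (cl : Set M → Set M) {n : ℕ} (A : Set M) (V : Set (Fin n → M)) :
    WithBot ℕ∞ :=
  ⨆ b ∈ V, (rank cl b A : WithBot ℕ∞)

end Matroids

section Topological

/-- `X ⊆ K` is dense in `K` with respect to `cl`: it meets every `K`-definable subset `φ(K, a)` of
`K` of dimension one. As `K` is an elementary substructure of `M` via `e`, the dimension of
`φ(K, a)` is that of the set `φ(M, a)` that the same formula defines in `M`. -/
def IsClDense {L : FirstOrder.Language.{u, v}} {K : Type*} {M : Type w} [L.Structure K]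
    [L.Structure M] (e : K ↪ₑ[L] M) (cl : Set M → Set M) (X : Set K) : Prop :=
  ∀ (n : ℕ) (φ : L.Formula (Fin 1 ⊕ Fin n)) (a : Fin n → K),
    dim cl (Set.range (e ∘ a)) {v : Fin 1 → M | v 0 ∈ fiber φ (e ∘ a)} = 1 →
    (fiber φ a ∩ X).Nonempty

/-- The closure operator `zcl` of a structure `M` with a topology: `b ∈ zcl A` if `b` lies in an
`A`-definable set with empty interior. -/
def zcl (L : FirstOrder.Language.{u, v}) {M : Type w} [L.Structure M] [TopologicalSpace M]
    (A : Set M) : Set M :=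
  {b | ∃ X : Set M, A.Definable₁ L X ∧ interior X = ∅ ∧ b ∈ X}

/-- `K` is d-minimal, where `M` is a monster model elementarily extending `K`, with its topology
given by the same formula. Finite powers carry the product topology. -/
structure IsDMinimal (L : FirstOrder.Language.{u, v}) (K : Type*) (M : Type w) [L.Structure K]
    [L.Structure M] [TopologicalSpace K] [TopologicalSpace M] : Prop where
  t1 : T1Space K
  no_isolated : ∀ x : K, ¬ IsOpen {x}
  finite_union : ∀ X : Set M, (univ : Set M).Definable₁ L X → interior X = ∅ →
    ∃ F : Set (Set M), F.Finite ∧ (∀ D ∈ F, IsDiscrete D) ∧ X = ⋃₀ F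
  projection : ∀ (n : ℕ) (X : Set (Fin (n + 1) → K)), (univ : Set K).Definable L X →
    IsDiscrete X → interior ((fun x => x 0) '' X) = ∅
  kuratowski_ulam : ∀ (X : Set (K × K)) (U : Set K), (univ : Set K).Definable₂ L X →
    (univ : Set K).Definable₁ L U → U ⊆ Prod.fst '' X → IsOpen U → U.Nonempty →
    (∀ a ∈ U, (interior {b : K | (a, b) ∈ X}).Nonempty) → (interior X).Nonempty

end Topological

end DMin

/-! Call a set small if finitely many discrete sets cover it. Small sets form an ideal, and a
definable subset of `M` is small iff its interior is empty (`InteriorEmptyIffSmall`). In a T1 space,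
a set covered by k discrete sets vanishes after k Cantor–Bendixson derivatives
(`iterate_derivative_eq_empty`). The basis being definable, derivatives need no new parameters, so
each point of an `A`-definable set with empty interior is isolated in some `A`-definable set. This
is (a).

The axioms on projections and on subsets of the plane speak of `K` only; their consequences for
formulas are first-order and pass to `M`. Idempotence: a union of discrete sets indexed by a
discrete set is the projection of a discrete subset of the plane
(`interior_sect_unionForm_eq_empty`). Exchange: a planar set whose slices in one direction are
discrete cannot have somewhere dense many slices with interior in the other, by Kuratowski–Ulam
(`exists_interior_sect_swapForm_nonempty`). Existence: since small sets form an ideal, saturation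
yields points avoiding every small set over given parameters (`exists_notMem_zcl`). For (c),
dimension 1 amounts to nonempty interior. -/

namespace DMin

/-! ### Cantor–Bendixson derivatives and finite unions of discrete sets -/

section Scattered

variable {X : Type*} [TopologicalSpace X]

/-- The isolated points of `S`. -/
def isolatedPoints (S : Set X) : Set X :=
  {x | x ∈ S ∧ ∃ U, IsOpen U ∧ x ∈ U ∧ ∀ y ∈ U, y ∈ S → y = x}

/-- The Cantor–Bendixson derivative of `S`, relative to `S` itself. -/
def derivative (S : Set X) : Set X := S \ isolatedPoints S

theorem isDiscrete_iff_subset_isolatedPoints {S : Set X} :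
    IsDiscrete S ↔ S ⊆ isolatedPoints S := by
  rw [isDiscrete_iff_forall_mem_exists_isOpen]
  constructor
  · intro h x hx
    obtain ⟨U, hU, hUS⟩ := h x hx
    refine ⟨hx, U, hU, ?_, fun y hy hyS => ?_⟩
    · exact (hUS.symm ▸ mem_singleton x : x ∈ U ∩ S).1
    · exact (hUS ▸ ⟨hy, hyS⟩ : y ∈ ({x} : Set X))
  · intro h x hx
    obtain ⟨_, U, hU, hxU, hS⟩ := h hx
    exact ⟨U, hU, Subset.antisymm (fun y hy => hS y hy.1 hy.2) (by rintro _ rfl; exact ⟨hxU, hx⟩)⟩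

theorem isDiscrete_isolatedPoints (S : Set X) : IsDiscrete (isolatedPoints S) := by
  rw [isDiscrete_iff_subset_isolatedPoints]
  rintro x ⟨hx, U, hU, hxU, h⟩
  exact ⟨⟨hx, U, hU, hxU, h⟩, U, hU, hxU, fun y hy hyS => h y hy hyS.1⟩

theorem isolatedPoints_inter_of_isOpen (S : Set X) {U : Set X} (hU : IsOpen U) :
    isolatedPoints (S ∩ U) = isolatedPoints S ∩ U := by
  ext x
  constructor
  · rintro ⟨⟨hx, hxU⟩, V, hV, hxV, h⟩
    exact ⟨⟨hx, V ∩ U, hV.inter hU, ⟨hxV, hxU⟩, fun y hy hyS => h y hy.1 ⟨hyS, hy.2⟩⟩, hxU⟩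
  · rintro ⟨⟨hx, V, hV, hxV, h⟩, hxU⟩
    exact ⟨⟨hx, hxU⟩, V, hV, hxV, fun y hy hyS => h y hy hyS.1⟩

theorem derivative_inter_of_isOpen (S : Set X) {U : Set X} (hU : IsOpen U) :
    derivative (S ∩ U) = derivative S ∩ U := by
  rw [derivative, derivative, isolatedPoints_inter_of_isOpen S hU]
  ext x
  simp only [mem_sdiff, mem_inter_iff]
  tauto

theorem iterate_derivative_inter_of_isOpen (k : ℕ) (S : Set X) {U : Set X} (hU : IsOpen U) :
    derivative^[k] (S ∩ U) = derivative^[k] S ∩ U := by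
  induction k with
  | zero => rfl
  | succ k ih =>
    rw [Function.iterate_succ_apply', Function.iterate_succ_apply', ih,
      derivative_inter_of_isOpen _ hU]

theorem iterate_derivative_subset (k : ℕ) (S : Set X) : derivative^[k] S ⊆ S := by
  induction k with
  | zero => exact Subset.rfl
  | succ k ih =>
    rw [Function.iterate_succ_apply']
    exact sdiff_subset.trans ih

/-- Induction on the number of discrete sets. Near a point x of D, only x itself needs D; off x the
remaining k sets cover `S`, so the k-th derivative has no other point near x, and x is isolated in
it. -/
theorem iterate_derivative_eq_empty [T1Space X] (k : ℕ) (F : Finset (Set X)) (hk : F.card = k)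
    (hF : ∀ D ∈ F, IsDiscrete D) (S : Set X) (hS : S ⊆ ⋃₀ (F : Set (Set X))) :
    derivative^[k] S = ∅ := by
  classical
  induction k generalizing F S with
  | zero =>
    obtain rfl := Finset.card_eq_zero.1 hk
    simpa using hS
  | succ k ih =>
    rw [Function.iterate_succ_apply', eq_empty_iff_forall_notMem]
    rintro x ⟨hx, hxi⟩
    obtain ⟨D, hDF, hxD⟩ := hS (iterate_derivative_subset k S hx)
    obtain ⟨-, U, hU, hxU, hD⟩ := isDiscrete_iff_subset_isolatedPoints.1 (hF D hDF) hxD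
    -- T1 enters here: the punctured neighbourhood is open, so derivatives can be computed inside
    -- it.
    have hU' : IsOpen (U \ {x}) := hU.sdiff isClosed_singleton
    have h := ih (F.erase D) (by rw [Finset.card_erase_of_mem hDF, hk]; rfl)
      (fun D' h => hF D' (Finset.mem_of_mem_erase h)) (S ∩ (U \ {x})) (by
        rintro y ⟨hyS, hyU, hyx⟩
        obtain ⟨D', hD', hyD'⟩ := hS hyS
        refine ⟨D', Finset.mem_coe.2 (Finset.mem_erase.2 ⟨?_, hD'⟩), hyD'⟩
        rintro rfl
        exact hyx (hD y hyU hyD'))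
    rw [iterate_derivative_inter_of_isOpen _ _ hU', eq_empty_iff_forall_notMem] at h
    refine hxi ⟨hx, U, hU, hxU, fun y hy hyS => ?_⟩
    by_contra hne
    exact h y ⟨hyS, hy, hne⟩

theorem exists_mem_isolatedPoints_of_iterate_derivative_eq_empty {k : ℕ} {S : Set X}
    (h : derivative^[k] S = ∅) {x : X} (hx : x ∈ S) :
    ∃ j, x ∈ isolatedPoints (derivative^[j] S) := by
  by_contra! hne
  have : ∀ j, x ∈ derivative^[j] S := by
    intro j
    induction j with
    | zero => exact hx
    | succ j ih =>
      rw [Function.iterate_succ_apply']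
      exact ⟨ih, hne j⟩
  exact (h ▸ this k : x ∈ (∅ : Set X))

/-- `S` is covered by finitely many discrete sets. -/
def IsSmall (S : Set X) : Prop :=
  ∃ F : Finset (Set X), (∀ D ∈ F, IsDiscrete D) ∧ S ⊆ ⋃₀ (F : Set (Set X))

theorem IsSmall.mono {S T : Set X} (h : IsSmall T) (hST : S ⊆ T) : IsSmall S :=
  let ⟨F, hF, hT⟩ := h
  ⟨F, hF, hST.trans hT⟩

theorem IsSmall.union {S T : Set X} (hS : IsSmall S) (hT : IsSmall T) : IsSmall (S ∪ T) := by
  classical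
  obtain ⟨F, hF, hS⟩ := hS
  obtain ⟨G, hG, hT⟩ := hT
  refine ⟨F ∪ G, fun D hD => (Finset.mem_union.1 hD).elim (hF D) (hG D), ?_⟩
  rw [Finset.coe_union, sUnion_union]
  exact union_subset_union hS hT

theorem _root_.IsDiscrete.isSmall {S : Set X} (h : IsDiscrete S) : IsSmall S :=
  ⟨{S}, by simpa using h, by simp⟩

theorem isSmall_empty : IsSmall (∅ : Set X) :=
  ⟨∅, by simp, by simp⟩

/-- Without isolated points in the space, an open set is its own derivative, so it can only vanish
under iteration if it is already empty. -/
theorem IsSmall.interior_eq_empty [T1Space X] (hX : ∀ x : X, ¬ IsOpen {x}) {S : Set X}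
    (h : IsSmall S) : interior S = ∅ := by
  obtain ⟨F, hF, hS⟩ := h
  have hd : derivative (interior S) = interior S := by
    refine Subset.antisymm sdiff_subset fun x hx => ⟨hx, ?_⟩
    rintro ⟨-, U, hU, hxU, h⟩
    refine hX x ?_
    convert hU.inter (isOpen_interior (s := S)) using 1
    exact Subset.antisymm (by rintro _ rfl; exact ⟨hxU, hx⟩) fun y hy => h y hy.1 hy.2
  rw [← iterate_derivative_eq_empty _ F rfl hF (interior S) (interior_subset.trans hS),
    Function.iterate_fixed hd]

end Scattered

/-! ### Topological notions as first-order formulas, uniformly in parameters -/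

section Formulas

variable {L : FirstOrder.Language.{u, v}} {N : Type*} [L.Structure N] {α : Type*} {m : ℕ}

/-- The set defined by `φ(v, x)` in the variable `x`. -/
def sect (φ : L.Formula (α ⊕ Fin 1)) (v : α → N) : Set N :=
  {x | φ.Realize (Sum.elim v fun _ => x)}

theorem mem_sect {φ : L.Formula (α ⊕ Fin 1)} {v : α → N} {x : N} :
    x ∈ sect φ v ↔ φ.Realize (Sum.elim v fun _ => x) :=
  Iff.rfl

theorem fiber_eq_sect {n : ℕ} (φ : L.Formula (Fin 1 ⊕ Fin n)) (a : Fin n → N) :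
    fiber φ a = sect (φ.relabel Sum.swap) a := by
  ext x
  simp only [fiber, sect, mem_ofPred_eq, FirstOrder.Language.Formula.realize_relabel]
  refine iff_of_eq (congrArg _ ?_)
  ext (i | i) <;> rfl

theorem sect_eq_fiber {n : ℕ} (φ : L.Formula (Fin n ⊕ Fin 1)) (a : Fin n → N) :
    sect φ a = fiber (φ.relabel Sum.swap) a := by
  ext x
  simp only [fiber, sect, mem_ofPred_eq, FirstOrder.Language.Formula.realize_relabel]
  refine iff_of_eq (congrArg _ ?_)
  ext (i | i) <;> rfl

/-- The formula `∃ x, φ(v, x)`. -/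
noncomputable def exForm (φ : L.Formula (α ⊕ Fin 1)) : L.Formula α := φ.iExs (Fin 1)

theorem realize_exForm {φ : L.Formula (α ⊕ Fin 1)} {v : α → N} :
    (exForm φ).Realize v ↔ ∃ x, x ∈ sect φ v := by
  rw [exForm, FirstOrder.Language.Formula.realize_iExs]
  refine ⟨fun ⟨i, hi⟩ => ⟨i 0, ?_⟩, fun ⟨x, hx⟩ => ⟨_, hx⟩⟩
  rw [mem_sect]
  convert hi with j

/-- The formula `Φ(x, w)`, with unused further parameters. -/
noncomputable def basicForm (Φ : L.Formula (Fin 1 ⊕ Fin m)) : L.Formula ((α ⊕ Fin m) ⊕ Fin 1) :=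
  Φ.relabel (Sum.elim Sum.inr (Sum.inl ∘ Sum.inr))

theorem sect_basicForm (Φ : L.Formula (Fin 1 ⊕ Fin m)) (v : α → N) (w : Fin m → N) :
    sect (basicForm Φ) (Sum.elim v w) = fiber Φ w := by
  ext x
  simp only [fiber, sect, basicForm, mem_ofPred_eq, FirstOrder.Language.Formula.realize_relabel]
  refine iff_of_eq (congrArg _ ?_)
  ext (i | i) <;> rfl

/-- Weakening of the parameters of `φ` by a further tuple of variables. -/
def weaken (β : Type*) (φ : L.Formula (α ⊕ Fin 1)) : L.Formula ((α ⊕ β) ⊕ Fin 1) :=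
  φ.relabel (Sum.map Sum.inl id)

theorem sect_weaken {β : Type*} (φ : L.Formula (α ⊕ Fin 1)) (v : α → N) (w : β → N) :
    sect (weaken β φ) (Sum.elim v w) = sect φ v := by
  ext x
  simp only [sect, weaken, mem_ofPred_eq, FirstOrder.Language.Formula.realize_relabel]
  refine iff_of_eq (congrArg _ ?_)
  ext (i | i) <;> rfl

theorem sect_inf (φ ψ : L.Formula (α ⊕ Fin 1)) (v : α → N) :
    sect (φ ⊓ ψ) v = sect φ v ∩ sect ψ v := by
  ext x
  simp [sect]

theorem sect_not (φ : L.Formula (α ⊕ Fin 1)) (v : α → N) :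
    sect φ.not v = (sect φ v)ᶜ := by
  ext x
  simp [sect]

/-- The formula `x = y`, with unused further parameters. -/
def eqForm (L : FirstOrder.Language.{u, v}) (α : Type*) : L.Formula ((α ⊕ Fin 1) ⊕ Fin 1) :=
  (FirstOrder.Language.Term.var (Sum.inr 0)).equal
    (FirstOrder.Language.Term.var (Sum.inl (Sum.inr 0)))

theorem sect_eqForm (v : α → N) (x : N) :
    sect (eqForm L α) (Sum.elim v fun _ => x) = {x} := by
  ext y
  simp [sect, eqForm]

theorem sect_imp (φ ψ : L.Formula (α ⊕ Fin 1)) (v : α → N) :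
    sect (φ.imp ψ) v = {x | x ∈ sect φ v → x ∈ sect ψ v} := by
  ext x
  simp [sect]

/-- The formula defining the points with a basic neighbourhood contained in `φ(v, ·)`. -/
noncomputable def interiorForm (Φ : L.Formula (Fin 1 ⊕ Fin m)) (φ : L.Formula (α ⊕ Fin 1)) :
    L.Formula (α ⊕ Fin 1) :=
  ((Φ.relabel (Sum.elim (Sum.inl ∘ Sum.inr) Sum.inr)) ⊓
    (exForm (basicForm Φ ⊓ (weaken (Fin m) (weaken (Fin 1) φ)).not)).not).iExs (Fin m)

/-- No topology is assumed, so this is available in `M` before the sets `Φ(M, w)` are known to form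
a basis. -/
theorem mem_sect_interiorForm {Φ : L.Formula (Fin 1 ⊕ Fin m)} {φ : L.Formula (α ⊕ Fin 1)}
    {v : α → N} {x : N} : x ∈ sect (interiorForm Φ φ) v ↔
      ∃ w : Fin m → N, x ∈ fiber Φ w ∧ fiber Φ w ⊆ sect φ v := by
  rw [mem_sect, interiorForm, FirstOrder.Language.Formula.realize_iExs]
  refine exists_congr fun w => ?_
  rw [FirstOrder.Language.Formula.realize_inf, FirstOrder.Language.Formula.realize_not,
    realize_exForm, sect_inf, sect_not, sect_weaken, sect_weaken, sect_basicForm,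
    FirstOrder.Language.Formula.realize_relabel]
  refine and_congr (iff_of_eq (congrArg _ ?_)) ?_
  · ext (i | i) <;> rfl
  · simp only [mem_inter_iff, mem_compl_iff, not_exists, not_and, not_not]
    rfl

theorem sect_interiorForm [TopologicalSpace N] {Φ : L.Formula (Fin 1 ⊕ Fin m)}
    (hN : IsTopologicalBasis (basicSets Φ N)) (φ : L.Formula (α ⊕ Fin 1)) (v : α → N) :
    sect (interiorForm Φ φ) v = interior (sect φ v) := by
  ext x
  rw [mem_sect_interiorForm]
  constructor
  · rintro ⟨w, hx, hw⟩
    exact interior_maximal hw (hN.isOpen ⟨w, rfl⟩) hx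
  · intro hx
    obtain ⟨_, ⟨w, rfl⟩, hxw, hw⟩ := hN.exists_subset_of_mem_open hx isOpen_interior
    exact ⟨w, hxw, hw.trans interior_subset⟩

/-- The formula saying that `φ(v, ·)` has nonempty interior. -/
noncomputable def somewhereForm (Φ : L.Formula (Fin 1 ⊕ Fin m)) (φ : L.Formula (α ⊕ Fin 1)) :
    L.Formula α :=
  exForm (interiorForm Φ φ)

theorem realize_somewhereForm [TopologicalSpace N] {Φ : L.Formula (Fin 1 ⊕ Fin m)}
    (hN : IsTopologicalBasis (basicSets Φ N)) {φ : L.Formula (α ⊕ Fin 1)} {v : α → N} :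
    (somewhereForm Φ φ).Realize v ↔ (interior (sect φ v)).Nonempty := by
  rw [somewhereForm, realize_exForm, sect_interiorForm hN]
  rfl

/-- The formula defining the isolated points of the set defined by `φ`. -/
noncomputable def isolatedForm (Φ : L.Formula (Fin 1 ⊕ Fin m)) (φ : L.Formula (α ⊕ Fin 1)) :
    L.Formula (α ⊕ Fin 1) :=
  φ ⊓ (interiorForm Φ ((weaken (Fin 1) φ).imp (eqForm L α))).relabel (Sum.elim id Sum.inr)

theorem sect_isolatedForm [TopologicalSpace N] {Φ : L.Formula (Fin 1 ⊕ Fin m)}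
    (hN : IsTopologicalBasis (basicSets Φ N)) (φ : L.Formula (α ⊕ Fin 1)) (v : α → N) :
    sect (isolatedForm Φ φ) v = isolatedPoints (sect φ v) := by
  ext x
  rw [isolatedForm, sect_inf]
  refine and_congr Iff.rfl ?_
  -- The relabelling makes one variable serve both as the point tested for interiority and as the
  -- point that the set is compared with.
  have h : x ∈ sect ((interiorForm Φ ((weaken (Fin 1) φ).imp (eqForm L α))).relabel
      (Sum.elim id Sum.inr)) v ↔ x ∈ sect (interiorForm Φ ((weaken (Fin 1) φ).imp (eqForm L α)))
        (Sum.elim v fun _ => x) := by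
    rw [mem_sect, mem_sect, FirstOrder.Language.Formula.realize_relabel]
    refine iff_of_eq (congrArg _ ?_)
    ext ((i | i) | i) <;> rfl
  rw [h, sect_interiorForm hN, sect_imp, sect_weaken, sect_eqForm, mem_interior]
  exact ⟨fun ⟨U, hS, hU, hx⟩ => ⟨U, hU, hx, hS⟩, fun ⟨U, hU, hx, hS⟩ => ⟨U, hS, hU, hx⟩⟩

/-- The formula defining the derivative of the set defined by `φ`. -/
noncomputable def derivativeForm (Φ : L.Formula (Fin 1 ⊕ Fin m)) (φ : L.Formula (α ⊕ Fin 1)) :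
    L.Formula (α ⊕ Fin 1) :=
  φ ⊓ (isolatedForm Φ φ).not

theorem sect_iterate_derivativeForm [TopologicalSpace N] {Φ : L.Formula (Fin 1 ⊕ Fin m)}
    (hN : IsTopologicalBasis (basicSets Φ N)) (φ : L.Formula (α ⊕ Fin 1)) (v : α → N) (k : ℕ) :
    sect ((derivativeForm Φ)^[k] φ) v = derivative^[k] (sect φ v) := by
  induction k with
  | zero => rfl
  | succ k ih =>
    rw [Function.iterate_succ_apply', Function.iterate_succ_apply', ← ih, derivativeForm, sect_inf,
      sect_not, sect_isolatedForm hN]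
    rfl

/-- The formula `∃ y, δ(v, y) ∧ ζ(v, y, x)`. -/
noncomputable def unionForm (δ : L.Formula (α ⊕ Fin 1)) (ζ : L.Formula ((α ⊕ Fin 1) ⊕ Fin 1)) :
    L.Formula (α ⊕ Fin 1) :=
  exForm (weaken (Fin 1) δ ⊓ ζ.relabel (Sum.elim (Sum.map Sum.inl id) (Sum.inl ∘ Sum.inr)))

theorem sect_unionForm (δ : L.Formula (α ⊕ Fin 1)) (ζ : L.Formula ((α ⊕ Fin 1) ⊕ Fin 1))
    (v : α → N) :
    sect (unionForm δ ζ) v = {x | ∃ y ∈ sect δ v, x ∈ sect ζ (Sum.elim v fun _ => y)} := by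
  ext x
  rw [mem_sect, unionForm, realize_exForm, sect_inf, sect_weaken]
  refine exists_congr fun y => and_congr Iff.rfl ?_
  rw [mem_sect, mem_sect, FirstOrder.Language.Formula.realize_relabel]
  refine iff_of_eq (congrArg _ ?_)
  ext ((i | i) | i) <;> rfl

/-- The formula `ψ(v, y, x)`, with the last two variables of `ψ` exchanged. -/
def swapForm (ψ : L.Formula ((α ⊕ Fin 1) ⊕ Fin 1)) : L.Formula ((α ⊕ Fin 1) ⊕ Fin 1) :=
  ψ.relabel (Sum.elim (Sum.map Sum.inl id) (Sum.inl ∘ Sum.inr))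

theorem mem_sect_swapForm (ψ : L.Formula ((α ⊕ Fin 1) ⊕ Fin 1)) (v : α → N) (x y : N) :
    y ∈ sect (swapForm ψ) (Sum.elim v fun _ => x) ↔ x ∈ sect ψ (Sum.elim v fun _ => y) := by
  rw [mem_sect, mem_sect, swapForm, FirstOrder.Language.Formula.realize_relabel]
  refine iff_of_eq (congrArg _ ?_)
  ext ((i | i) | i) <;> rfl

end Formulas

/-! ### Transfer from `K` to the monster model -/

section Transfer

variable {L : FirstOrder.Language.{u, v}} {K : Type w'} {M : Type w} [L.Structure K]
  [L.Structure M] {α : Type*} {m : ℕ}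

/-- A counterexample in `M` involves only the finitely many free variables of `θ`, so its existence
is a sentence, which `K` then satisfies too. Hence `α` may be infinite, such as a parameter set. -/
theorem realize_of_forall_realize [Nonempty K] (e : K ↪ₑ[L] M) (θ : L.Formula α)
    (h : ∀ v : α → K, θ.Realize v) (v : α → M) : θ.Realize v := by
  classical
  by_contra hv
  have hM : M ⊨ θ.not.exClosure := by
    rw [FirstOrder.Language.Formula.realize_exClosure]
    refine ⟨v ∘ (↑), ?_⟩
    exact (FirstOrder.Language.BoundedFormula.realize_restrictFreeVar v (by simp)).2 hv
  rw [← e.map_sentence, FirstOrder.Language.Formula.realize_exClosure] at hM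
  obtain ⟨w, hw⟩ := hM
  -- Variables not occurring in `θ` get an arbitrary value.
  let w' : α → K := fun a => if ha : a ∈ θ.not.freeVarFinset then w ⟨a, ha⟩ else
    Classical.arbitrary K
  have hw' : θ.not.Realize w' :=
    (FirstOrder.Language.BoundedFormula.realize_restrictFreeVar w'
      fun a => by simp only [w', dif_pos a.2]; rfl).1 hw
  exact hw' (h w')

theorem eq_elim_const (v : α ⊕ Fin 1 → M) :
    v = Sum.elim (v ∘ Sum.inl) fun _ => v (Sum.inr 0) := by
  ext (i | i)
  · rfl
  · rw [Subsingleton.elim i 0]; rfl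

theorem realize_iff_mem_sect (φ : L.Formula (α ⊕ Fin 1)) (v : α ⊕ Fin 1 → M) :
    φ.Realize v ↔ v (Sum.inr 0) ∈ sect φ (v ∘ Sum.inl) := by
  rw [mem_sect, ← eq_elim_const]

/-- The topology of `M` is only generated by the sets `Φ(M, w)`. That they cover `M`, and that each
point of an intersection of two has a third inside it, are first-order properties inherited from
`K`. -/
theorem isTopologicalBasis_of_elementary [Nonempty K] [TopologicalSpace K] [tM : TopologicalSpace M]
    {Φ : L.Formula (Fin 1 ⊕ Fin m)} (hK : IsTopologicalBasis (basicSets Φ K))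
    (hM : tM = TopologicalSpace.generateFrom (basicSets Φ M)) (e : K ↪ₑ[L] M) :
    IsTopologicalBasis (basicSets Φ M) := by
  refine ⟨?_, ?_, hM⟩
  · rintro _ ⟨w₁, rfl⟩ _ ⟨w₂, rfl⟩ x hx
    let φ₁ : L.Formula ((Fin m ⊕ Fin m) ⊕ Fin 1) := weaken (Fin m) (Φ.relabel Sum.swap)
    let φ : L.Formula ((Fin m ⊕ Fin m) ⊕ Fin 1) := φ₁ ⊓ basicForm Φ
    have key := realize_of_forall_realize e (φ.imp (interiorForm Φ φ)) ?_
      (Sum.elim (Sum.elim w₁ w₂) fun _ => x)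
    · rw [FirstOrder.Language.Formula.realize_imp, ← mem_sect, ← mem_sect,
        mem_sect_interiorForm, sect_inf, sect_basicForm, sect_weaken, ← fiber_eq_sect] at key
      obtain ⟨w, hxw, hw⟩ := key hx
      exact ⟨_, ⟨w, rfl⟩, hxw, hw⟩
    · intro v
      rw [FirstOrder.Language.Formula.realize_imp, realize_iff_mem_sect, realize_iff_mem_sect,
        mem_sect_interiorForm, ← Sum.elim_comp_inl_inr (v ∘ Sum.inl), sect_inf, sect_basicForm,
        sect_weaken, ← fiber_eq_sect]
      intro hx
      obtain ⟨_, ⟨w, rfl⟩, hxw, hw⟩ := hK.exists_subset_inter _ ⟨_, rfl⟩ _ ⟨_, rfl⟩ _ hx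
      exact ⟨w, hxw, hw⟩
  · refine eq_univ_of_forall fun x => ?_
    have key := realize_of_forall_realize e (interiorForm Φ (⊤ : L.Formula (Fin 0 ⊕ Fin 1))) ?_
      (Sum.elim default fun _ => x)
    · rw [← mem_sect, mem_sect_interiorForm] at key
      obtain ⟨w, hxw, -⟩ := key
      exact ⟨_, ⟨w, rfl⟩, hxw⟩
    · intro v
      rw [realize_iff_mem_sect, mem_sect_interiorForm]
      obtain ⟨_, ⟨w, rfl⟩, hxw⟩ := hK.sUnion_eq.symm ▸ mem_univ (v (Sum.inr 0))
      exact ⟨w, hxw, fun y _ => by simp [sect]⟩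

theorem t1Space_of_elementary [Nonempty K] [TopologicalSpace K] [TopologicalSpace M]
    {Φ : L.Formula (Fin 1 ⊕ Fin m)} (hK : IsTopologicalBasis (basicSets Φ K))
    (hM : IsTopologicalBasis (basicSets Φ M)) (e : K ↪ₑ[L] M) [T1Space K] : T1Space M := by
  refine ⟨fun x => isOpen_compl_iff.1 (interior_eq_iff_isOpen.1 ?_)⟩
  refine interior_subset.antisymm fun y hy => ?_
  have key := realize_of_forall_realize e
    ((eqForm L (Fin 0)).not.imp (interiorForm Φ (eqForm L (Fin 0)).not)) ?_
    (Sum.elim (Sum.elim default fun _ => x) fun _ => y)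
  · rw [FirstOrder.Language.Formula.realize_imp, ← mem_sect, ← mem_sect, sect_interiorForm hM,
      sect_not, sect_eqForm] at key
    exact key hy
  · intro v
    rw [FirstOrder.Language.Formula.realize_imp, realize_iff_mem_sect, realize_iff_mem_sect,
      sect_interiorForm hK, sect_not, eq_elim_const (v ∘ Sum.inl), sect_eqForm,
      isOpen_compl_singleton.interior_eq]
    exact id

theorem not_isOpen_singleton_of_elementary [Nonempty K] [TopologicalSpace K] [TopologicalSpace M]
    {Φ : L.Formula (Fin 1 ⊕ Fin m)} (hK : IsTopologicalBasis (basicSets Φ K))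
    (hM : IsTopologicalBasis (basicSets Φ M)) (e : K ↪ₑ[L] M) (h : ∀ x : K, ¬ IsOpen {x})
    (x : M) : ¬ IsOpen {x} := by
  intro hx
  have key := realize_of_forall_realize e (somewhereForm Φ (eqForm L (Fin 0))).not ?_
    (Sum.elim default fun _ => x)
  · rw [FirstOrder.Language.Formula.realize_not, realize_somewhereForm hM, sect_eqForm,
      hx.interior_eq] at key
    exact key (singleton_nonempty x)
  · intro v
    rw [FirstOrder.Language.Formula.realize_not, realize_somewhereForm hK, eq_elim_const v,
      sect_eqForm]
    rintro ⟨y, hy⟩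
    refine h (v (Sum.inr 0)) (interior_eq_iff_isOpen.1 (interior_subset.antisymm ?_))
    rintro _ rfl
    exact interior_subset hy ▸ hy

theorem definable_setOf_realize {A : Set M} {β : Type*} (χ : L.Formula (α ⊕ β)) (v : α → M)
    (hv : ∀ i, v i ∈ A) : A.Definable L {y : β → M | χ.Realize (Sum.elim v y)} := by
  rw [definable_iff_exists_formula_sum]
  refine ⟨χ.relabel (Sum.map (fun i => ⟨v i, hv i⟩) id), ?_⟩
  ext y
  simp only [mem_ofPred_eq, FirstOrder.Language.Formula.realize_relabel]
  refine iff_of_eq (congrArg _ ?_)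
  ext (i | i) <;> rfl

theorem definable₁_sect {A : Set M} (φ : L.Formula (α ⊕ Fin 1)) (v : α → M)
    (hv : ∀ i, v i ∈ A) : A.Definable₁ L (sect φ v) := by
  have : {x : Fin 1 → M | x 0 ∈ sect φ v} = {x | φ.Realize (Sum.elim v x)} := by
    ext x
    simp only [mem_ofPred_eq, realize_iff_mem_sect]
    rfl
  rw [Definable₁, this]
  exact definable_setOf_realize φ v hv

theorem definable₁_iff {A : Set M} {X : Set M} :
    A.Definable₁ L X ↔ ∃ φ : L.Formula (A ⊕ Fin 1), X = sect φ (↑) := by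
  constructor
  · intro h
    obtain ⟨φ, hφ⟩ := definable_iff_exists_formula_sum.1 h
    refine ⟨φ, ?_⟩
    ext x
    exact Set.ext_iff.1 hφ fun _ => x
  · rintro ⟨φ, rfl⟩
    exact definable₁_sect φ _ fun i => i.2

/-- Turns the parameter `c` into a variable, so that it can be varied. -/
theorem exists_sect_insert (A : Set M) (c : M) (φ : L.Formula (↑(insert c A) ⊕ Fin 1)) :
    ∃ ψ : L.Formula ((A ⊕ Fin 1) ⊕ Fin 1),
      sect φ (↑) = sect ψ (Sum.elim ((↑) : A → M) fun _ => c) := by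
  classical
  let f : ↑(insert c A) → A ⊕ Fin 1 := fun i =>
    if h : (i : M) ∈ A then Sum.inl ⟨i, h⟩ else Sum.inr 0
  have hf : ∀ i, Sum.elim ((↑) : A → M) (fun _ => c) (f i) = i := by
    intro i
    by_cases h : (i : M) ∈ A
    · simp [f, h]
    · simpa [f, h] using (i.2.resolve_right h).symm
  refine ⟨φ.relabel (Sum.map f id), ?_⟩
  ext x
  rw [mem_sect, mem_sect, FirstOrder.Language.Formula.realize_relabel]
  refine iff_of_eq (congrArg _ ?_)
  ext (i | i)
  · exact (hf i).symm
  · rfl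

/-- In a d-minimal structure, the union of discrete sets indexed by a discrete set has empty
interior. -/
theorem interior_sect_unionForm_eq_empty [Nonempty K] [TopologicalSpace K] [TopologicalSpace M]
    {Φ : L.Formula (Fin 1 ⊕ Fin m)} (hK : IsTopologicalBasis (basicSets Φ K))
    (hM : IsTopologicalBasis (basicSets Φ M)) (e : K ↪ₑ[L] M) (hd : IsDMinimal L K M)
    (δ : L.Formula (α ⊕ Fin 1)) (ζ : L.Formula ((α ⊕ Fin 1) ⊕ Fin 1)) (v : α → M) :
    interior (sect (unionForm (isolatedForm Φ δ) (isolatedForm Φ ζ)) v) = ∅ := by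
  have key := realize_of_forall_realize e
    (somewhereForm Φ (unionForm (isolatedForm Φ δ) (isolatedForm Φ ζ))).not ?_ v
  · rwa [FirstOrder.Language.Formula.realize_not, realize_somewhereForm hM,
      not_nonempty_iff_eq_empty] at key
  intro v
  rw [FirstOrder.Language.Formula.realize_not, realize_somewhereForm hK,
    not_nonempty_iff_eq_empty, sect_unionForm, sect_isolatedForm hK]
  simp only [sect_isolatedForm hK]
  -- The indexing point is put in coordinate 1, because the projection axiom concerns coordinate 0.
  let X : Set (Fin 2 → K) := {p | p 1 ∈ isolatedPoints (sect δ v) ∧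
    p 0 ∈ isolatedPoints (sect ζ (Sum.elim v fun _ => p 1))}
  have hX : (univ : Set K).Definable L X := by
    have := definable_setOf_realize (A := univ) (β := Fin 2)
      ((isolatedForm Φ δ).relabel (Sum.map id fun _ => 1) ⊓
        (isolatedForm Φ ζ).relabel (Sum.elim (Sum.map id fun _ => 1) fun _ => Sum.inr 0)) v
      fun _ => mem_univ _
    convert this using 1
    ext p
    simp only [X, mem_ofPred_eq, ← sect_isolatedForm hK, FirstOrder.Language.Formula.realize_inf,
      FirstOrder.Language.Formula.realize_relabel, mem_sect]
    refine and_congr (iff_of_eq (congrArg _ ?_)) (iff_of_eq (congrArg _ ?_))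
    · ext (i | i) <;> rfl
    · ext ((i | i) | i) <;> rfl
  -- `U` isolates the indexing point; once it is fixed, both points lie in the same slice, where `V`
  -- isolates.
  have hXd : IsDiscrete X := by
    rw [isDiscrete_iff_subset_isolatedPoints]
    rintro p ⟨hp1, hp0⟩
    obtain ⟨-, U, hU, hpU, hU'⟩ := id hp1
    obtain ⟨-, V, hV, hpV, hV'⟩ := id hp0
    refine ⟨⟨hp1, hp0⟩, {q | q 1 ∈ U} ∩ {q | q 0 ∈ V}, ?_, ⟨hpU, hpV⟩, ?_⟩
    · exact (hU.preimage (continuous_apply 1)).inter (hV.preimage (continuous_apply 0))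
    · rintro q ⟨hqU, hqV⟩ ⟨hq1, hq0⟩
      have h1 : q 1 = p 1 := hU' _ hqU hq1.1
      have h0 : q 0 = p 0 := hV' _ hqV (h1 ▸ hq0.1)
      ext i
      fin_cases i
      · exact h0
      · exact h1
  convert hd.projection 1 X hX hXd using 2
  ext x
  constructor
  · rintro ⟨y, hy, hx⟩
    exact ⟨![x, y], ⟨hy, hx⟩, rfl⟩
  · rintro ⟨p, ⟨h1, h0⟩, rfl⟩
    exact ⟨p 1, h1, h0⟩

/-- The Kuratowski–Ulam property passes to elementary extensions. -/
theorem exists_interior_sect_swapForm_nonempty [Nonempty K] [TopologicalSpace K]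
    [TopologicalSpace M]
    {Φ : L.Formula (Fin 1 ⊕ Fin m)} (hK : IsTopologicalBasis (basicSets Φ K))
    (hM : IsTopologicalBasis (basicSets Φ M)) (e : K ↪ₑ[L] M) (hd : IsDMinimal L K M)
    (ψ : L.Formula ((α ⊕ Fin 1) ⊕ Fin 1)) (v : α → M)
    (h : (interior {x : M | (interior (sect ψ (Sum.elim v fun _ => x))).Nonempty}).Nonempty) :
    ∃ y : M, (interior (sect (swapForm ψ) (Sum.elim v fun _ => y))).Nonempty := by
  -- One slice with interior is a weaker conclusion than interior in the plane, but it suffices and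
  -- is expressed by `somewhereForm`.
  have key := realize_of_forall_realize e
    ((somewhereForm Φ (somewhereForm Φ ψ)).imp (exForm (somewhereForm Φ (swapForm ψ)))) ?_ v
  · rw [FirstOrder.Language.Formula.realize_imp, realize_somewhereForm hM, realize_exForm] at key
    simp only [sect, realize_somewhereForm hM] at key
    exact key h
  intro v
  rw [FirstOrder.Language.Formula.realize_imp, somewhereForm, realize_exForm, realize_exForm]
  simp only [mem_sect_interiorForm]
  simp only [mem_sect, realize_somewhereForm hK]
  rintro ⟨x, w, hw, hwU⟩
  let X : Set (K × K) := {p | p.2 ∈ sect ψ (Sum.elim v fun _ => p.1)}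
  have hwU' : ∀ a ∈ fiber Φ w, (interior {b | (a, b) ∈ X}).Nonempty := fun a ha =>
    (realize_somewhereForm hK).1 (hwU ha)
  have hXd : (univ : Set K).Definable₂ L X := by
    have := definable_setOf_realize (A := univ) (β := Fin 2)
      (ψ.relabel (Sum.elim (Sum.map id fun _ => 0) fun _ => Sum.inr 1)) v fun _ => mem_univ _
    rw [Definable₂]
    convert this using 1
    ext p
    simp only [X, mem_ofPred_eq, mem_sect, FirstOrder.Language.Formula.realize_relabel]
    refine iff_of_eq (congrArg _ ?_)
    ext ((i | i) | i) <;> rfl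
  have hint := hd.kuratowski_ulam X (fiber Φ w) hXd
    (by rw [fiber_eq_sect]; exact definable₁_sect _ _ fun _ => mem_univ _)
    (fun a ha => let ⟨b, hb⟩ := hwU' a ha; ⟨(a, b), interior_subset (s := {b | (a, b) ∈ X}) hb, rfl⟩)
    (hK.isOpen ⟨w, rfl⟩) ⟨x, hw⟩ hwU'
  obtain ⟨⟨x, y⟩, hxy⟩ := hint
  -- The slice at height `y` of the open set `interior X` is open and contains `x`.
  refine ⟨y, x, ?_⟩
  refine interior_maximal (t := (fun x => (x, y)) ⁻¹' interior X) (fun x' hx' => ?_)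
    (isOpen_interior.preimage (by fun_prop)) hxy
  rw [mem_sect_swapForm]
  exact interior_subset (s := X) hx'

end Transfer

/-! ### The closure operator `zcl` -/

section Zcl

variable {L : FirstOrder.Language.{u, v}} {M : Type w} [L.Structure M] [TopologicalSpace M] {m : ℕ}

/-- The definable subsets of `M` with empty interior are the small ones. -/
def InteriorEmptyIffSmall (L : FirstOrder.Language.{u, v}) (M : Type w) [L.Structure M]
    [TopologicalSpace M] : Prop :=
  ∀ X : Set M, (univ : Set M).Definable₁ L X → (interior X = ∅ ↔ IsSmall X)

theorem IsDMinimal.interiorEmptyIffSmall {K : Type*} [L.Structure K] [TopologicalSpace K]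
    [T1Space M] (hiso : ∀ x : M, ¬ IsOpen {x}) (hd : IsDMinimal L K M) :
    InteriorEmptyIffSmall L M := by
  refine fun X hX => ⟨fun h => ?_, IsSmall.interior_eq_empty hiso⟩
  obtain ⟨F, hF, hFd, rfl⟩ := hd.finite_union X hX h
  exact ⟨hF.toFinset, by simpa using hFd, by simp⟩

theorem definable₁_isolatedPoints_iterate_derivative {Φ : L.Formula (Fin 1 ⊕ Fin m)}
    (hM : IsTopologicalBasis (basicSets Φ M)) {A X : Set M} (hX : A.Definable₁ L X) (j : ℕ) :
    A.Definable₁ L (isolatedPoints (derivative^[j] X)) := by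
  obtain ⟨φ, rfl⟩ := definable₁_iff.1 hX
  rw [← sect_iterate_derivativeForm hM, ← sect_isolatedForm hM]
  exact definable₁_sect _ _ fun i => i.2

theorem mem_zcl_iff_isDiscrete [T1Space M] (hs : InteriorEmptyIffSmall L M)
    {Φ : L.Formula (Fin 1 ⊕ Fin m)} (hM : IsTopologicalBasis (basicSets Φ M)) {A : Set M} {b : M} :
    b ∈ zcl L A ↔ ∃ X : Set M, A.Definable₁ L X ∧ IsDiscrete X ∧ b ∈ X := by
  constructor
  · rintro ⟨X, hX, hint, hb⟩
    obtain ⟨F, hF, hXF⟩ := (hs X (hX.mono (subset_univ A))).1 hint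
    obtain ⟨j, hj⟩ := exists_mem_isolatedPoints_of_iterate_derivative_eq_empty
      (iterate_derivative_eq_empty _ F rfl hF X hXF) hb
    exact ⟨_, definable₁_isolatedPoints_iterate_derivative hM hX j, isDiscrete_isolatedPoints _, hj⟩
  · rintro ⟨X, hX, hXd, hb⟩
    exact ⟨X, hX, (hs X (hX.mono (subset_univ A))).2 hXd.isSmall, hb⟩

/-- Isolated points form a discrete set for every value of the parameters, so discreteness survives
when a parameter is varied. -/
theorem mem_zcl_iff_isolatedPoints [T1Space M] (hs : InteriorEmptyIffSmall L M)
    {Φ : L.Formula (Fin 1 ⊕ Fin m)} (hM : IsTopologicalBasis (basicSets Φ M)) {A : Set M} {b : M} :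
    b ∈ zcl L A ↔ ∃ φ : L.Formula (A ⊕ Fin 1), b ∈ isolatedPoints (sect φ (↑)) := by
  rw [mem_zcl_iff_isDiscrete hs hM]
  constructor
  · rintro ⟨X, hX, hXd, hb⟩
    obtain ⟨φ, rfl⟩ := definable₁_iff.1 hX
    exact ⟨φ, isDiscrete_iff_subset_isolatedPoints.1 hXd hb⟩
  · rintro ⟨φ, hb⟩
    refine ⟨_, ?_, isDiscrete_isolatedPoints _, hb⟩
    rw [← sect_isolatedForm hM]
    exact definable₁_sect _ _ fun i => i.2

theorem zcl_mono {A B : Set M} (h : A ⊆ B) : zcl L A ⊆ zcl L B :=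
  fun _ ⟨X, hX, hint, hb⟩ => ⟨X, hX.mono h, hint, hb⟩

theorem subset_zcl [T1Space M] (hs : InteriorEmptyIffSmall L M) (A : Set M) : A ⊆ zcl L A :=
  fun a ha => ⟨{a}, Definable.singleton_of_mem L ha,
    (hs _ (Definable.singleton_of_mem L (mem_univ a))).2
      (subsingleton_singleton.isDiscrete).isSmall, rfl⟩

theorem exists_finset_mem_zcl {A : Set M} {b : M} (h : b ∈ zcl L A) :
    ∃ A₀ : Finset M, (A₀ : Set M) ⊆ A ∧ b ∈ zcl L (A₀ : Set M) := by
  obtain ⟨X, hX, hint, hb⟩ := h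
  obtain ⟨A₀, hA₀, hX₀⟩ := definable_iff_finitely_definable.1 hX
  exact ⟨A₀, hA₀, X, hX₀, hint, hb⟩

/-! ### The matroid axioms -/

section Extension

variable {K : Type w'} [Nonempty K] [L.Structure K] [TopologicalSpace K] [T1Space M]
  {Φ : L.Formula (Fin 1 ⊕ Fin m)}

theorem mem_zcl_of_mem_zcl_insert (hK : IsTopologicalBasis (basicSets Φ K))
    (hM : IsTopologicalBasis (basicSets Φ M)) (e : K ↪ₑ[L] M) (hd : IsDMinimal L K M)
    (hs : InteriorEmptyIffSmall L M) {A : Set M} {b c : M} (hb : b ∈ zcl L (insert c A))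
    (hc : c ∈ zcl L A) : b ∈ zcl L A := by
  obtain ⟨φ, hφ⟩ := (mem_zcl_iff_isolatedPoints hs hM).1 hb
  obtain ⟨ζ, hζ⟩ := exists_sect_insert A c φ
  obtain ⟨δ, hδ⟩ := (mem_zcl_iff_isolatedPoints hs hM).1 hc
  rw [hζ] at hφ
  refine ⟨_, definable₁_sect _ _ fun i => i.2,
    interior_sect_unionForm_eq_empty hK hM e hd δ ζ (fun i : A => (i : M)), ?_⟩
  rw [sect_unionForm, sect_isolatedForm hM]
  refine ⟨c, hδ, ?_⟩
  rw [sect_isolatedForm hM]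
  exact hφ

theorem zcl_zcl (hK : IsTopologicalBasis (basicSets Φ K))
    (hM : IsTopologicalBasis (basicSets Φ M)) (e : K ↪ₑ[L] M) (hd : IsDMinimal L K M)
    (hs : InteriorEmptyIffSmall L M) (A : Set M) : zcl L (zcl L A) = zcl L A := by
  classical
  refine Subset.antisymm (fun b hb => ?_) (subset_zcl hs _)
  obtain ⟨F, hF, hbF⟩ := exists_finset_mem_zcl hb
  -- With `A` adjoined, the elements of `F` can be removed one at a time.
  replace hbF : b ∈ zcl L (↑F ∪ A) := zcl_mono subset_union_left hbF
  induction F using Finset.induction_on with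
  | empty => simpa using hbF
  | insert c F _ ih =>
    rw [Finset.coe_insert, insert_subset_iff] at hF
    rw [Finset.coe_insert, insert_union] at hbF
    exact ih hF.2 (mem_zcl_of_mem_zcl_insert hK hM e hd hs hbF (zcl_mono subset_union_right hF.1))

/-- If `c` were not in the closure of `A` and `a`, the slice over `a` through `c` would have
interior. So would the `A`-definable set of points with such slices, as it contains `a`.
Kuratowski–Ulam then gives interior to a slice in the other direction, but those are discrete. -/
theorem zcl_exchange (hK : IsTopologicalBasis (basicSets Φ K))
    (hM : IsTopologicalBasis (basicSets Φ M)) (e : K ↪ₑ[L] M) (hd : IsDMinimal L K M)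
    (hiso : ∀ x : M, ¬ IsOpen {x}) (hs : InteriorEmptyIffSmall L M) {A : Set M} {a c : M}
    (ha : a ∈ zcl L (insert c A)) (haA : a ∉ zcl L A) : c ∈ zcl L (insert a A) := by
  by_contra hc
  obtain ⟨φ, hφ⟩ := (mem_zcl_iff_isolatedPoints hs hM).1 ha
  obtain ⟨ζ, hζ⟩ := exists_sect_insert A c φ
  rw [hζ, ← sect_isolatedForm hM] at hφ
  let v : A → M := (↑)
  let ψ := swapForm (isolatedForm Φ ζ)
  have hca : c ∈ sect ψ (Sum.elim v fun _ => a) := (mem_sect_swapForm _ _ _ _).2 hφ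
  have h1 : (interior (sect ψ (Sum.elim v fun _ => a))).Nonempty := by
    rw [nonempty_iff_ne_empty]
    intro h
    refine hc ⟨_, definable₁_sect _ _ ?_, h, hca⟩
    rintro (i | i)
    · exact mem_insert_of_mem _ i.2
    · exact mem_insert _ _
  have hU : {x : M | (interior (sect ψ (Sum.elim v fun _ => x))).Nonempty} =
      sect (somewhereForm Φ ψ) v := by
    ext x
    exact (realize_somewhereForm hM).symm
  have h2 : (interior {x : M | (interior (sect ψ (Sum.elim v fun _ => x))).Nonempty}).Nonempty := by
    rw [nonempty_iff_ne_empty]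
    intro h
    rw [hU] at h
    exact haA ⟨_, definable₁_sect _ _ fun i => i.2, h, (realize_somewhereForm hM).2 h1⟩
  obtain ⟨y, hy⟩ := exists_interior_sect_swapForm_nonempty hK hM e hd ψ v h2
  have hy' : sect (swapForm ψ) (Sum.elim v fun _ => y) =
      isolatedPoints (sect ζ (Sum.elim v fun _ => y)) := by
    rw [← sect_isolatedForm hM]
    ext x
    rw [mem_sect_swapForm, mem_sect_swapForm]
  rw [hy', (isDiscrete_isolatedPoints _).isSmall.interior_eq_empty hiso] at hy
  exact not_nonempty_empty hy

theorem isFinitaryMatroid_zcl (hK : IsTopologicalBasis (basicSets Φ K))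
    (hM : IsTopologicalBasis (basicSets Φ M)) (e : K ↪ₑ[L] M) (hd : IsDMinimal L K M)
    (hiso : ∀ x : M, ¬ IsOpen {x}) (hs : InteriorEmptyIffSmall L M) :
    IsFinitaryMatroid (zcl L : Set M → Set M) where
  extension := subset_zcl hs
  monotone _ _ := zcl_mono
  idempotent := zcl_zcl hK hM e hd hs
  finitary A := by
    refine Subset.antisymm (fun b hb => ?_) (iUnion₂_subset fun B hB => zcl_mono hB.1)
    obtain ⟨F, hF, hbF⟩ := exists_finset_mem_zcl hb
    exact mem_biUnion (x := (F : Set M)) ⟨hF, F.finite_toSet⟩ hbF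
  exchange _ _ _ := zcl_exchange hK hM e hd hiso hs

end Extension

theorem isDefinableOperator_zcl {Φ : L.Formula (Fin 1 ⊕ Fin m)}
    (hM : IsTopologicalBasis (basicSets Φ M)) :
    IsDefinableOperator L (zcl L : Set M → Set M) := by
  refine fun A => Subset.antisymm (fun b hb => ?_) ?_
  · obtain ⟨F, hF, X, hX, hint, hbX⟩ := exists_finset_mem_zcl hb
    obtain ⟨φ, rfl⟩ := definable₁_iff.1 hX
    let f : Fin F.card ≃ F := F.equivFin.symm
    let a : Fin F.card → M := fun i => f i
    let ψ : L.Formula (Fin F.card ⊕ Fin 1) := φ.relabel (Sum.map f.symm id)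
    have hψ : sect ψ a = sect φ (↑) := by
      ext x
      rw [mem_sect, mem_sect, FirstOrder.Language.Formula.realize_relabel]
      refine iff_of_eq (congrArg _ ?_)
      ext (i | i)
      · simp [a]
      · rfl
    -- Conjoining the condition that the fibre has empty interior makes the formula narrow at all
    -- parameters, without changing it at `a`.
    let χ : L.Formula (Fin F.card ⊕ Fin 1) :=
      ψ ⊓ (somewhereForm Φ ψ).not.relabel Sum.inl
    have hχ : ∀ (c : Fin F.card → M) (x : M), x ∈ sect χ c ↔
        x ∈ sect ψ c ∧ interior (sect ψ c) = ∅ := by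
      intro c x
      rw [mem_sect, FirstOrder.Language.Formula.realize_inf]
      refine and_congr Iff.rfl ?_
      rw [FirstOrder.Language.Formula.realize_relabel, Sum.elim_comp_inl,
        FirstOrder.Language.Formula.realize_not, realize_somewhereForm hM,
        not_nonempty_iff_eq_empty]
    refine ⟨F.card, χ.relabel Sum.swap, a, fun c x hx => ?_, fun i => hF (f i).2, ?_⟩
    · rw [← sect_eq_fiber, hχ] at hx
      exact ⟨_, definable₁_sect _ _ fun i => mem_range_self i, hx.2, hx.1⟩
    · rw [← sect_eq_fiber, hχ, hψ]
      exact ⟨hbX, hint⟩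
  · rintro x ⟨n, φ, a, hφ, ha, hx⟩
    exact zcl_mono (range_subset_iff.2 ha) (hφ a x hx)

/-- Realize the partial type of all formulas containing some member of `S` up to a small set. It
includes the members of `S` and the complements of small `A`-definable sets. A finite part contains
a single `Y` up to a small set; were it unsatisfiable, `Y` would be small. -/
theorem exists_notMem_zcl (hs : InteriorEmptyIffSmall L M) {κ : Cardinal.{w}}
    (hκ : IsSaturated L M κ) {A : Set M} (hA : #A < κ) {S : Set (Set M)}
    (hSA : ∀ Y ∈ S, A.Definable₁ L Y) (hSn : S.Nonempty) (hSi : ∀ Y ∈ S, ∀ Z ∈ S, Y ∩ Z ∈ S)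
    (hS : ∀ Y ∈ S, (interior Y).Nonempty) : ∃ a, (∀ Y ∈ S, a ∈ Y) ∧ a ∉ zcl L A := by
  classical
  obtain ⟨a, ha⟩ := hκ A hA
    {θ | ∃ Y ∈ S, IsSmall (Y \ {x | θ.Realize fun _ => x})} fun s hs' => by
    have : ∃ Y ∈ S, IsSmall (Y \ {x | ∀ θ ∈ s, θ.Realize fun _ => x}) := by
      induction s using Finset.induction_on with
      | empty =>
        obtain ⟨Y, hY⟩ := hSn
        exact ⟨Y, hY, by simpa using isSmall_empty⟩
      | insert θ s _ ih =>
        rw [Finset.coe_insert, insert_subset_iff] at hs'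
        obtain ⟨Y, hY, hYs⟩ := ih hs'.2
        obtain ⟨Z, hZ, hZs⟩ := hs'.1
        refine ⟨Y ∩ Z, hSi Y hY Z hZ, (hYs.union hZs).mono ?_⟩
        rintro x ⟨⟨hxY, hxZ⟩, hx⟩
        simp only [Finset.mem_insert, forall_eq_or_imp, mem_ofPred_eq, not_and_or] at hx
        exact hx.elim (fun h => Or.inr ⟨hxZ, h⟩) fun h => Or.inl ⟨hxY, h⟩
    obtain ⟨Y, hY, hYs⟩ := this
    by_contra! hne
    refine (hS Y hY).ne_empty ((hs Y ((hSA Y hY).mono (subset_univ A))).2 (hYs.mono ?_))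
    intro x hx
    refine ⟨hx, fun h => ?_⟩
    obtain ⟨θ, hθ, hxθ⟩ := hne x
    exact hxθ (h θ hθ)
  have def_iff : ∀ Z : Set M, A.Definable₁ L Z →
      ∃ θ : (L[[A]]).Formula (Fin 1), Z = {x | θ.Realize fun _ => x} := by
    rintro Z ⟨θ, hθ⟩
    refine ⟨θ, ?_⟩
    ext x
    exact Set.ext_iff.1 hθ fun _ => x
  refine ⟨a, fun Y hY => ?_, ?_⟩
  · obtain ⟨θ, hθ⟩ := def_iff Y (hSA Y hY)
    rw [hθ]
    exact ha θ ⟨Y, hY, by rw [← hθ, sdiff_self]; exact isSmall_empty⟩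
  · rintro ⟨X, hX, hint, haX⟩
    obtain ⟨θ, hθ⟩ := def_iff Xᶜ hX.compl
    obtain ⟨Y, hY⟩ := hSn
    have : a ∈ Xᶜ := by
      rw [hθ]
      refine ha θ ⟨Y, hY, ?_⟩
      rw [← hθ]
      exact ((hs X (hX.mono (subset_univ A))).1 hint).mono fun x hx => not_not.1 hx.2
    exact this haX

/-- The `B`-definable sets containing `a` have interior because `a` is not in the closure of `B`; a
point of all of them outside the closure of `B ∪ C` is as required. -/
theorem satisfiesExistence_zcl (hs : InteriorEmptyIffSmall L M) {κ : Cardinal.{w}}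
    (hκ : IsSaturated L M κ) (hκ₀ : ℵ₀ ≤ κ) :
    SatisfiesExistence L κ (zcl L : Set M → Set M) := by
  intro a B C hB hC ha
  obtain ⟨a', ha', hz⟩ := exists_notMem_zcl hs hκ
    ((Cardinal.mk_union_le B C).trans_lt (Cardinal.add_lt_of_lt hκ₀ hB hC))
    (S := {Y | B.Definable₁ L Y ∧ a ∈ Y}) (fun Y hY => hY.1.mono subset_union_left)
    ⟨univ, definable_univ, mem_univ a⟩ (fun Y hY Z hZ => ⟨hY.1.inter hZ.1, hY.2, hZ.2⟩)
    (fun Y hY => nonempty_iff_ne_empty.2 fun h => ha ⟨Y, hY.1, h, hY.2⟩)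
  have hdef : ∀ φ : (L[[B]]).Formula (Fin 1), B.Definable₁ L {x | φ.Realize fun _ => x} := by
    refine fun φ => ⟨φ, ?_⟩
    ext x
    simp only [mem_ofPred_eq]
    refine iff_of_eq (congrArg _ ?_)
    ext i
    rw [Subsingleton.elim i 0]
  refine ⟨a', fun φ => ⟨fun h => ha' _ ⟨hdef φ, h⟩, fun h => ?_⟩, hz⟩
  by_contra hna
  exact ha' {x | φ.Realize fun _ => x}ᶜ ⟨(hdef φ).compl, hna⟩ h

theorem exists_mem_notMem_zcl (hs : InteriorEmptyIffSmall L M) {κ : Cardinal.{w}}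
    (hκ : IsSaturated L M κ) {A : Set M} (hA : #A < κ) {Y : Set M} (hY : A.Definable₁ L Y)
    (hint : (interior Y).Nonempty) : ∃ a ∈ Y, a ∉ zcl L A := by
  obtain ⟨a, ha, hz⟩ := exists_notMem_zcl hs hκ hA (S := {Y}) (by simpa using hY)
    (singleton_nonempty Y) (by simp) (by simpa using hint)
  exact ⟨a, ha Y rfl, hz⟩

end Zcl

/-! ### Rank and dimension in one variable -/

section Dimension

variable {M : Type w}

theorem one_le_rank {cl : Set M → Set M} {b : Fin 1 → M} {A : Set M} (h : b 0 ∉ cl A) :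
    1 ≤ rank cl b A := by
  have : ({b 0} : Set M) ∈ {S : Set M | S ⊆ Set.range b ∧ IndepOver cl A S} := by
    refine ⟨singleton_subset_iff.2 (mem_range_self 0), ?_⟩
    rintro _ rfl
    simpa using h
  rw [← encard_singleton (b 0)]
  exact le_iSup₂ (f := fun (S : Set M) (_ : S ∈ _) => S.encard) _ this

theorem rank_le_one (cl : Set M → Set M) (b : Fin 1 → M) (A : Set M) : rank cl b A ≤ 1 := by
  refine iSup₂_le fun S hS => encard_le_one_iff_subsingleton.2 (subsingleton_range b |>.anti hS.1)

theorem rank_le_zero {cl : Set M → Set M} {b : Fin 1 → M} {A : Set M} (h : b 0 ∈ cl A) :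
    rank cl b A ≤ 0 := by
  refine iSup₂_le fun S hS => ?_
  rw [nonpos_iff_eq_zero, encard_eq_zero, eq_empty_iff_forall_notMem]
  intro x hx
  have hsub : S ⊆ {x} := fun y hy => (subsingleton_range b) (hS.1 hy) (hS.1 hx)
  obtain ⟨i, rfl⟩ := hS.1 hx
  have := hS.2 _ hx
  rw [sdiff_eq_empty.2 hsub, union_empty, Subsingleton.elim i 0] at this
  exact this h

theorem dim_eq_one_iff {cl : Set M → Set M} {A : Set M} {V : Set (Fin 1 → M)} :
    dim cl A V = 1 ↔ ∃ b ∈ V, b 0 ∉ cl A := by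
  constructor
  · intro h
    by_contra! hne
    -- This includes the case of empty `V`, where the supremum is `⊥`.
    have : dim cl A V ≤ 0 := iSup₂_le fun b hb => WithBot.coe_le_coe.2 (rank_le_zero (hne b hb))
    rw [h] at this
    exact absurd this (by decide)
  · rintro ⟨b, hb, h⟩
    refine le_antisymm (iSup₂_le fun b _ => WithBot.coe_le_coe.2 (rank_le_one cl b A)) ?_
    exact (WithBot.coe_le_coe.2 (one_le_rank h)).trans
      (le_iSup₂ (f := fun (b : Fin 1 → M) (_ : b ∈ V) => (rank cl b A : WithBot ℕ∞)) b hb)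

end Dimension

/-! ### Topological density and `zcl`-density -/

section Density

variable {L : FirstOrder.Language.{u, v}} {K : Type w'} {M : Type w} [L.Structure K]
  [L.Structure M] [TopologicalSpace K] [TopologicalSpace M] {m : ℕ}

/-- Dimension 1 means having a point in `M` outside the closure of the parameters. By saturation
this amounts to nonempty interior in `M`, a first-order condition that can be read off in `K`. -/
theorem isClDense_zcl_iff_dense {Φ : L.Formula (Fin 1 ⊕ Fin m)}
    (hK : IsTopologicalBasis (basicSets Φ K)) (hM : IsTopologicalBasis (basicSets Φ M))
    (e : K ↪ₑ[L] M) (hs : InteriorEmptyIffSmall L M) {κ : Cardinal.{w}} (hκ : IsSaturated L M κ)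
    (hκ₀ : ℵ₀ ≤ κ) (X : Set K) : IsClDense e (zcl L : Set M → Set M) X ↔ Dense X := by
  have key : ∀ (n : ℕ) (φ : L.Formula (Fin 1 ⊕ Fin n)) (a : Fin n → K),
      dim (zcl L) (Set.range (e ∘ a)) {v : Fin 1 → M | v 0 ∈ fiber φ (e ∘ a)} = 1 ↔
        (interior (fiber φ a)).Nonempty := by
    intro n φ a
    rw [fiber_eq_sect, fiber_eq_sect, ← realize_somewhereForm hK, ← e.map_formula,
      realize_somewhereForm hM, dim_eq_one_iff]
    have hdef : (range (e ∘ a)).Definable₁ L (sect (φ.relabel Sum.swap) (e ∘ a)) :=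
      definable₁_sect _ _ fun i => mem_range_self i
    constructor
    · rintro ⟨b, hb, hz⟩
      rw [nonempty_iff_ne_empty]
      exact fun h => hz ⟨_, hdef, h, hb⟩
    · intro h
      obtain ⟨b, hb, hz⟩ := exists_mem_notMem_zcl hs hκ
        ((Cardinal.lt_aleph0_of_finite _).trans_le hκ₀) hdef h
      exact ⟨fun _ => b, hb, hz⟩
  simp only [IsClDense, key]
  constructor
  · intro h
    rw [hK.dense_iff]
    rintro _ ⟨w, rfl⟩ hne
    exact h m Φ w (by rwa [(hK.isOpen ⟨w, rfl⟩).interior_eq])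
  · intro h n φ a hne
    exact (h.inter_open_nonempty _ isOpen_interior hne).mono
      (inter_subset_inter_left _ interior_subset)

end Density

end DMin

theorem mainTheorem7 {L : FirstOrder.Language.{u, v}} {K : Type w'} {M : Type w}
    [L.Structure K] [L.Structure M] [Nonempty K]
    [tK : TopologicalSpace K] [tM : TopologicalSpace M]
    {m : ℕ} (Φ : L.Formula (Fin 1 ⊕ Fin m))
    (hK : TopologicalSpace.IsTopologicalBasis (DMin.basicSets Φ K))
    (hM : tM = TopologicalSpace.generateFrom (DMin.basicSets Φ M))
    (κ : Cardinal.{w}) (hκ : DMin.IsMonster L M κ) (e : K ↪ₑ[L] M)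
    (hd : DMin.IsDMinimal L K M) :
    (∀ (A : Set M) (b : M), b ∈ DMin.zcl L A ↔
      ∃ X : Set M, A.Definable₁ L X ∧ IsDiscrete X ∧ b ∈ X) ∧
    DMin.IsExistentialMatroid L κ (DMin.zcl L : Set M → Set M) ∧
    (∀ X : Set K, DMin.IsClDense e (DMin.zcl L : Set M → Set M) X ↔ Dense X) := by
  have := hd.t1
  have hM := DMin.isTopologicalBasis_of_elementary hK hM e
  have := DMin.t1Space_of_elementary hK hM e
  have hiso := DMin.not_isOpen_singleton_of_elementary hK hM e hd.no_isolated
  have hs := hd.interiorEmptyIffSmall hiso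
  have hκ₀ : ℵ₀ ≤ κ := by
    have h := (Cardinal.lift_le.2 (le_max_left ℵ₀ L.card)).trans_lt hκ.card_lt
    simpa using h.le
  refine ⟨fun A b => DMin.mem_zcl_iff_isDiscrete hs hM,
    ⟨DMin.isFinitaryMatroid_zcl hK hM e hd hiso hs, DMin.isDefinableOperator_zcl hM,
      DMin.satisfiesExistence_zcl hs hκ.saturated hκ₀, fun h => ?_⟩,
    DMin.isClDense_zcl_iff_dense hK hM e hs hκ.saturated hκ₀⟩
  obtain ⟨x⟩ := ‹Nonempty K›
  -- Non-triviality: the whole space has nonempty interior, so some point avoids the closure of the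
  -- empty set.
  obtain ⟨a, -, ha⟩ := DMin.exists_mem_notMem_zcl hs hκ.saturated
    (A := ∅) (by simpa using Cardinal.aleph0_pos.trans_le hκ₀) (Y := univ) definable_univ
    ⟨e x, by simp⟩
  exact ha (h ▸ mem_univ a)
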